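/- Let $\Delta$ be a flag simplicial complex on $[n]=\{1,\dots,n\}$, i.e. a non-empty family of subsets of $[n]$ closed under taking subsets (so $\emptyset\in\Delta$), such that $\{i\}\in\Delta$ for all $i$, and such that $F\in\Delta$ whenever $|F|>2$ and $\{i,j\}\in\Delta$ for all distinct $i,j\in F$. The dimension of a face $F$ is $|F|-1$, $\dim\Delta$ is the largest dimension of a face, and facets are the inclusion-maximal faces. Write $i\sim j$ if $\{i,j\}\in\Delta$ (so $i\sim i$), and for $S\subseteq[n]$ put $H_S=\{u\in\mathbb{C}^n : u_s=0 \text{ for all } s\in S\}$. A binary geometry for $\Delta$ is an affine algebraic variety $\tilde U\subset\mathbb{C}^n$ of dimension $\dim\Delta+1$ that, for some integers $a_{ij}>0$, is the common zero set of the $n$ polynomials $$R_i = u_i+\prod_{j\,:\,j\not\sim i}u_j^{a_{ij}}-1,\qquad i=1,\dots,n,$$ and such that for every $S\subseteq[n]$ the variety $\tilde U\cap H_S$ is non-empty if and only if $S\in\Delta$, and in that case it is irreducible and pure of codimension $|S|$ in $\tilde U$. **Theorem.** If there is a binary geometry for $\Delta$, then $\Delta$ is a pseudomanifold; that is, $\Delta$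 is pure (all facets have the same dimension $d=\dim\Delta$), and every $(d-1)$-dimensional face of $\Delta$ is contained in exactly two facets. -/

import Mathlib

noncomputable section

/-- A simplicial complex on the vertex set `ι`: a non-empty collection of finite subsets of `ι`,
closed under passing to subsets. The empty set is always a face (this is why Mathlib's
`AbstractSimplicialComplex`, whose faces are non-empty, is not used), and an element of `ι` need
not be a vertex. -/
structure SimplicialComplexOn (ι : Type*) where
  /-- the faces -/
  faces : Finset (Finset ι)
  down_closed : ∀ F ∈ faces, ∀ G : Finset ι, G ⊆ F → G ∈ faces
  nonempty : faces.Nonempty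

namespace SimplicialComplexOn

variable {ι : Type*}

/-- The dimension: the size of the largest face, minus one. -/
def dim (Δ : SimplicialComplexOn ι) : ℤ :=
  ((Δ.faces.sup Finset.card : ℕ) : ℤ) - 1

/-- The dimension of a face: its size minus one. -/
def faceDim (F : Finset ι) : ℤ := (F.card : ℤ) - 1

/-- Facets are the faces that are maximal under inclusion. -/
def IsFacet (Δ : SimplicialComplexOn ι) (F : Finset ι) : Prop :=
  F ∈ Δ.faces ∧ ∀ G ∈ Δ.faces, F ⊆ G → G = F

/-- All facets have the same dimension. -/
def IsPure (Δ : SimplicialComplexOn ι) : Prop :=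
  ∀ F G : Finset ι, Δ.IsFacet F → Δ.IsFacet G → faceDim F = faceDim G

/-- A pure `d`-dimensional complex is a pseudomanifold if every `(d-1)`-dimensional face is
contained in exactly two facets. -/
def IsPseudomanifold (Δ : SimplicialComplexOn ι) : Prop :=
  Δ.IsPure ∧ ∀ F ∈ Δ.faces, faceDim F = Δ.dim - 1 →
    {G : Finset ι | Δ.IsFacet G ∧ F ⊆ G}.ncard = 2

variable [DecidableEq ι]

/-- `i ∼ j`: the set `{i, j}` is a face. For `i = j` this says that `{i}` is a face. -/
def Compatible (Δ : SimplicialComplexOn ι) (i j : ι) : Prop :=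
  ({i, j} : Finset ι) ∈ Δ.faces

/-- Every `{i}` is a face, and a set with more than two elements, any two of which form a face,
is a face. -/
def IsFlag (Δ : SimplicialComplexOn ι) : Prop :=
  (∀ i : ι, {i} ∈ Δ.faces) ∧
    ∀ F : Finset ι, 2 < F.card →
      (∀ i ∈ F, ∀ j ∈ F, i ≠ j → ({i, j} : Finset ι) ∈ Δ.faces) → F ∈ Δ.faces

end SimplicialComplexOn

namespace AffineVariety

open MvPolynomial

variable {ι : Type*}

/-- Zariski closed subsets of the complex affine space with coordinates indexed by `ι`. -/
def IsAlgebraicSet (V : Set (ι → ℂ)) : Prop :=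
  ∃ I : Ideal (MvPolynomial ι ℂ), V = zeroLocus ℂ I

/-- `V` is irreducible in the Zariski topology: it is non-empty, and whenever it is covered by two
Zariski closed sets, it lies in one of them. -/
def IsIrred (V : Set (ι → ℂ)) : Prop :=
  V.Nonempty ∧ ∀ A B : Set (ι → ℂ), IsAlgebraicSet A → IsAlgebraicSet B →
    V ⊆ A ∪ B → V ⊆ A ∨ V ⊆ B

/-- The dimension of a variety: the Krull dimension of its coordinate ring (`⊥` if empty). -/
def varietyDim (V : Set (ι → ℂ)) : WithBot ℕ∞ :=
  ringKrullDim (MvPolynomial ι ℂ ⧸ vanishingIdeal ℂ V)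

/-- `Z` is an irreducible component of `W`: a maximal irreducible Zariski closed subset. -/
def IsComponent (Z W : Set (ι → ℂ)) : Prop :=
  Maximal (fun Y : Set (ι → ℂ) => IsAlgebraicSet Y ∧ IsIrred Y ∧ Y ⊆ W) Z

/-- `W` is pure of codimension `c` in the irreducible variety `V`: every irreducible component of
`W` has dimension `dim V - c`. -/
def IsPureOfCodim (W V : Set (ι → ℂ)) (c : ℕ) : Prop :=
  ∀ Z : Set (ι → ℂ), IsComponent Z W → varietyDim Z + (c : WithBot ℕ∞) = varietyDim V

/-- The coordinate subspace `H_S`, where the coordinates indexed by `S` vanish. -/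
def coordSubspace (S : Finset ι) : Set (ι → ℂ) := {x | ∀ s ∈ S, x s = 0}

variable [Fintype ι] [DecidableEq ι]

open Classical in
/-- The polynomial `R_i = u_i + ∏_{j ≁ i} u_j ^ a_{ij} - 1`. -/
def uPoly (Δ : SimplicialComplexOn ι) (a : ι → ι → ℕ) (i : ι) : MvPolynomial ι ℂ :=
  X i + ∏ j ∈ Finset.univ.filter (fun j => ¬ Δ.Compatible j i), X j ^ a i j - 1

/-- `U` is a binary geometry for the (flag) complex `Δ`: it is the common zero set of polynomials
`R_i` with positive exponents, its dimension is `dim Δ + 1`, and `U ∩ H_S` is non-empty exactly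
for the faces `S` of `Δ`, in which case it is irreducible and pure of codimension `|S|` in `U`
(for `S = ∅` this says that `U` itself is irreducible). -/
structure IsBinaryGeometry (Δ : SimplicialComplexOn ι) (U : Set (ι → ℂ)) : Prop where
  cut_out : ∃ a : ι → ι → ℕ, (∀ i j, ¬ Δ.Compatible j i → 0 < a i j) ∧
    U = {x | ∀ i, eval x (uPoly Δ a i) = 0}
  dim_eq : ∃ d : ℕ, (d : ℤ) = Δ.dim + 1 ∧ varietyDim U = (d : WithBot ℕ∞)
  nonempty_iff : ∀ S : Finset ι, (U ∩ coordSubspace S).Nonempty ↔ S ∈ Δ.faces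
  irreducible : ∀ S ∈ Δ.faces, IsIrred (U ∩ coordSubspace S)
  pure_codim : ∀ S ∈ Δ.faces, IsPureOfCodim (U ∩ coordSubspace S) U S.card

end AffineVariety

end

/-! ### Expansions in powers of an element of a domain -/

section Algebra

variable {A κ : Type*} [CommRing A]

/-! On the section of the variety by a face `F`, every coordinate outside `F` that does not extend
`F` to a face equals 1. For a facet this leaves a single point, of dimension 0, so purity of
codimension fixes the size of `F` (`card_facet`). If `F` is one vertex short of a facet, the section
is an irreducible curve on which only the coordinates of the link vertices vary, and these vertices
are pairwise incompatible. Fix one of them, with coordinate `t`. It is non-zero in the coordinate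
ring, a domain, but vanishes at a point of the curve. Expanding the other link coordinates in powers
of `t`, the equations force exactly one further link vertex (`card_eq_one_of_binary_relations`),
hence two facets through `F`. -/

theorem dvd_prod_pow_sub_one (d : A) (K : Finset κ) (u : κ → A) (c : κ → ℕ)
    (h : ∀ k ∈ K, d ∣ u k - 1) : d ∣ ∏ k ∈ K, u k ^ c k - 1 := by
  simp only [← Ideal.mem_span_singleton, ← Ideal.Quotient.eq] at h ⊢
  rw [map_prod, map_one]
  refine Finset.prod_eq_one fun k hk => ?_
  rw [map_pow, h k hk, map_one, one_pow]

/-- First-order calculus: the cross term contains `t ^ (2 * e)`, which dies modulo `t ^ (e + 1)`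
because `e ≥ 1`. -/
theorem pow_succ_dvd_mul_sub {t x y : A} {e : ℕ} (he : 1 ≤ e) {α β : A}
    (hx : t ^ (e + 1) ∣ x - (1 - α * t ^ e)) (hy : t ^ (e + 1) ∣ y - (1 - β * t ^ e)) :
    t ^ (e + 1) ∣ x * y - (1 - (α + β) * t ^ e) := by
  have h2 : t ^ (e + 1) ∣ t ^ e * t ^ e := by
    rw [← pow_add]
    exact pow_dvd_pow _ (by omega)
  have := ((hx.mul_right y).add (hy.mul_left (1 - α * t ^ e))).add (h2.mul_left (α * β))
  convert this using 1
  ring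

theorem pow_succ_dvd_pow_sub {t x : A} {e : ℕ} (he : 1 ≤ e) {α : A} (b : ℕ)
    (hx : t ^ (e + 1) ∣ x - (1 - α * t ^ e)) :
    t ^ (e + 1) ∣ x ^ b - (1 - (b * α) * t ^ e) := by
  induction b with
  | zero => simp
  | succ b ih =>
    have := pow_succ_dvd_mul_sub he ih hx
    convert this using 1
    push_cast
    ring

theorem pow_succ_dvd_prod_pow_sub {t : A} {e : ℕ} (he : 1 ≤ e) (K : Finset κ) (u : κ → A)
    (b α : κ → ℕ) (h : ∀ k ∈ K, t ^ (e + 1) ∣ u k - (1 - α k * t ^ e)) :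
    t ^ (e + 1) ∣ ∏ k ∈ K, u k ^ b k - (1 - ((∑ k ∈ K, b k * α k : ℕ) : A) * t ^ e) := by
  classical
  induction K using Finset.induction_on with
  | empty => simp
  | insert k K hk ih =>
    rw [Finset.prod_insert hk, Finset.sum_insert hk]
    have := pow_succ_dvd_mul_sub he
      (pow_succ_dvd_pow_sub he (b k) (h k (Finset.mem_insert_self k K)))
      (ih fun l hl => h l (Finset.mem_insert_of_mem hl))
    convert this using 4
    push_cast
    ring

theorem pow_succ_dvd_one_sub_pow_mul {t w : A} {a e : ℕ} (hea : e ≤ a) (hw : t ∣ w - 1) :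
    t ^ (e + 1) ∣ (1 - t ^ a * w) - (1 - ((if a = e then 1 else 0 : ℕ) : A) * t ^ e) := by
  split_ifs with h
  · subst h
    have := (mul_dvd_mul_left (t ^ a) hw).neg_right
    rw [pow_succ]
    convert this using 1
    push_cast
    ring
  · have : t ^ (e + 1) ∣ t ^ a := pow_dvd_pow _ (by omega)
    convert (this.mul_right w).neg_right using 1
    push_cast
    ring

/-- If `t` is a non-zero element of a domain dividing no non-zero integer, the relations
`u k = 1 - t ^ a k * ∏ l ≠ k, u l ^ c k l` and `t + ∏ k, u k ^ b k = 1` with positive exponents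
are only possible for a single unknown `u k`. -/
theorem card_eq_one_of_binary_relations [IsDomain A] [DecidableEq κ] {K : Finset κ} {t : A}
    (ht : t ≠ 0) (hdvd : ∀ n : ℤ, t ∣ (n : A) → n = 0) (u : κ → A) (a b : κ → ℕ)
    (c : κ → κ → ℕ) (ha : ∀ k ∈ K, 0 < a k) (hb : ∀ k ∈ K, 0 < b k)
    (hu : ∀ k ∈ K, u k = 1 - t ^ a k * ∏ l ∈ K.erase k, u l ^ c k l)
    (h : t + ∏ k ∈ K, u k ^ b k = 1) : K.card = 1 := by
  have hcancel : ∀ (n : ℤ) (e : ℕ), t ^ (e + 1) ∣ (n : A) * t ^ e → n = 0 := by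
    intro n e hn
    rw [pow_succ', mul_dvd_mul_iff_right (pow_ne_zero e ht)] at hn
    exact hdvd n hn
  have hu1 : ∀ k ∈ K, t ∣ u k - 1 := by
    intro k hk
    rw [hu k hk]
    have := ((dvd_pow_self t (ha k hk).ne').mul_right (∏ l ∈ K.erase k, u l ^ c k l)).neg_right
    convert this using 1
    ring
  have hw : ∀ k ∈ K, t ∣ ∏ l ∈ K.erase k, u l ^ c k l - 1 := fun k _ =>
    dvd_prod_pow_sub_one t _ u _ fun l hl => hu1 l (Finset.mem_of_mem_erase hl)
  have hexp : ∀ e, ∀ k ∈ K, e ≤ a k →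
      t ^ (e + 1) ∣ u k - (1 - ((if a k = e then 1 else 0 : ℕ) : A) * t ^ e) := by
    intro e k hk he
    have := pow_succ_dvd_one_sub_pow_mul he (hw k hk)
    rwa [← hu k hk] at this
  -- Compare coefficients of `t` in `h` modulo `t ^ 2`. The sum being 1 leaves exactly one `k₀` with
  -- `a k₀ = 1`, and `b k₀ = 1`.
  have hsum : ∑ k ∈ K, b k * (if a k = 1 then 1 else 0) = 1 := by
    have h1 := pow_succ_dvd_prod_pow_sub le_rfl K u b _ fun k hk => hexp 1 k hk (ha k hk)
    set N := ∑ k ∈ K, b k * (if a k = 1 then 1 else 0) with hN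
    have := hcancel ((N : ℤ) - 1) 1 (by
      convert h1 using 1
      push_cast
      linear_combination -h)
    omega
  obtain ⟨k₀, hk₀, haone⟩ : ∃ k ∈ K, a k = 1 := by
    by_contra! hne
    rw [Finset.sum_eq_zero fun k hk => by simp [hne k hk]] at hsum
    exact zero_ne_one hsum
  rw [← Finset.add_sum_erase _ _ hk₀] at hsum
  simp only [haone, if_true, mul_one] at hsum
  have hbk₀ := hb k₀ hk₀
  have hbone : b k₀ = 1 := by omega
  have ha2 : ∀ k ∈ K.erase k₀, 2 ≤ a k := by
    intro k hk
    have h0 := Finset.sum_eq_zero_iff.mp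
      (show ∑ x ∈ K.erase k₀, b x * (if a x = 1 then 1 else 0) = 0 by omega) k hk
    have hk' := Finset.mem_of_mem_erase hk
    have := ha k hk'
    have := hb k hk'
    by_contra hlt
    rw [if_pos (by omega)] at h0
    omega
  rw [← Finset.card_erase_add_one hk₀, Nat.add_eq_right, Finset.card_eq_zero]
  by_contra hne
  -- The next exponent `e ≥ 2` is the lowest order at which the remaining unknowns differ from 1.
  obtain ⟨k₁, hk₁, hmin⟩ :=
    Finset.exists_min_image (K.erase k₀) a (Finset.nonempty_iff_ne_empty.mpr hne)
  set e := a k₁ with he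
  have he1 : 1 ≤ e := by have := ha2 k₁ hk₁; omega
  have hrest := pow_succ_dvd_prod_pow_sub he1 (K.erase k₀) u b _
    fun k hk => hexp e k (Finset.mem_of_mem_erase hk) (hmin k hk)
  set N := ∑ k ∈ K.erase k₀, b k * (if a k = e then 1 else 0) with hN
  have hNpos : 0 < N := by
    refine Finset.sum_pos' (fun _ _ => Nat.zero_le _) ⟨k₁, hk₁, ?_⟩
    simpa [he] using hb k₁ (Finset.mem_of_mem_erase hk₁)
  -- The product omits `u k₀`, the only unknown of order 1, so `u k₀` agrees with `1 - t` modulo `t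
  -- ^ (e + 1)`.
  have hwk₀ : t ^ e ∣ ∏ l ∈ K.erase k₀, u l ^ c k₀ l - 1 := by
    refine dvd_prod_pow_sub_one _ _ u _ fun l hl => ?_
    rw [hu l (Finset.mem_of_mem_erase hl)]
    have := ((pow_dvd_pow t (hmin l hl)).mul_right (∏ m ∈ K.erase l, u m ^ c l m)).neg_right
    convert this using 1
    ring
  have hk₀u := hu k₀ hk₀
  rw [haone, pow_one] at hk₀u
  rw [← Finset.mul_prod_erase _ _ hk₀, hbone, pow_one] at h
  generalize ∏ l ∈ K.erase k₀, u l ^ c k₀ l = w at hwk₀ hk₀u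
  generalize ∏ l ∈ K.erase k₀, u l ^ b l = v at hrest h
  obtain ⟨r, hr⟩ := hwk₀
  obtain ⟨s, hs⟩ := hrest
  -- Now `h` reads `(1 - t) * (1 - N * t ^ e) ≡ 1 - t` modulo `t ^ (e + 1)`, which forces `N = 0`.
  have := hcancel N e ⟨(N : A) - r * v + (1 - t) * s, by
    push_cast
    linear_combination (-1 : A) * h + v * hk₀u - (t * v) * hr + (1 - t) * hs⟩
  omega

end Algebra

/-! ### Flag complexes and links -/

namespace SimplicialComplexOn

variable {ι : Type*} {Δ : SimplicialComplexOn ι}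

theorem isFacet_of_card {F : Finset ι} (hF : F ∈ Δ.faces)
    (hc : Δ.faces.sup Finset.card ≤ F.card) : Δ.IsFacet F :=
  ⟨hF, fun _ hG hFG =>
    (Finset.eq_of_subset_of_card_le hFG ((Finset.le_sup (f := Finset.card) hG).trans hc)).symm⟩

variable [DecidableEq ι]

theorem IsFlag.exists_not_compatible (hΔ : Δ.IsFlag) {F : Finset ι}
    (hF : F ∈ Δ.faces) {j : ι} (hj : insert j F ∉ Δ.faces) : ∃ i ∈ F, ¬ Δ.Compatible i j := by
  by_contra! h
  apply hj
  by_cases hjF : j ∈ F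
  · rwa [Finset.insert_eq_of_mem hjF]
  have hcomm : ∀ i ∈ F, ({j, i} : Finset ι) ∈ Δ.faces := fun i hi => by
    rw [Finset.pair_comm]
    exact h i hi
  rcases Nat.lt_or_ge 2 (insert j F).card with hlt | hle
  · refine hΔ.2 _ hlt fun k hk l hl hkl => ?_
    rw [Finset.mem_insert] at hk hl
    rcases hk with rfl | hk <;> rcases hl with rfl | hl
    · exact absurd rfl hkl
    · exact hcomm l hl
    · exact h k hk
    · refine Δ.down_closed F hF _ ?_
      simp [Finset.insert_subset_iff, hk, hl]
  · rw [Finset.card_insert_of_notMem hjF] at hle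
    rcases F.eq_empty_or_nonempty with rfl | ⟨i, hi⟩
    · exact hΔ.1 j
    · obtain rfl : F = {i} :=
        (Finset.eq_of_subset_of_card_le (Finset.singleton_subset_iff.mpr hi) (by simp; omega)).symm
      exact hcomm i hi

/-- The vertices of the link of a face. -/
def linkVertices [Fintype ι] (Δ : SimplicialComplexOn ι) (F : Finset ι) : Finset ι :=
  Finset.univ.filter fun j => j ∉ F ∧ insert j F ∈ Δ.faces

theorem mem_linkVertices [Fintype ι] {F : Finset ι} {j : ι} :
    j ∈ Δ.linkVertices F ↔ j ∉ F ∧ insert j F ∈ Δ.faces := by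
  simp [linkVertices]

/-- By flagness, two compatible link vertices would extend `F` to a face with `F.card + 2` elements,
above the maximum. -/
theorem IsFlag.not_compatible_of_mem_linkVertices [Fintype ι] (hΔ : Δ.IsFlag) {F : Finset ι}
    (hc : F.card + 1 = Δ.faces.sup Finset.card) {i j : ι} (hi : i ∈ Δ.linkVertices F)
    (hj : j ∈ Δ.linkVertices F) (hij : i ≠ j) : ¬ Δ.Compatible i j := by
  intro hcomp
  rw [mem_linkVertices] at hi hj
  by_cases hmem : insert j (insert i F) ∈ Δ.faces
  · have := Finset.le_sup (f := Finset.card) hmem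
    rw [Finset.card_insert_of_notMem (by simp [hij.symm, hj.1]),
      Finset.card_insert_of_notMem hi.1] at this
    omega
  · obtain ⟨k, hk, hkj⟩ := hΔ.exists_not_compatible hi.2 hmem
    rw [Finset.mem_insert] at hk
    rcases hk with rfl | hk
    · exact hkj hcomp
    · refine hkj (Δ.down_closed _ hj.2 _ ?_)
      simp [Finset.insert_subset_iff, hk]

end SimplicialComplexOn

/-! ### Algebraic sets, irreducibility and dimension -/

namespace AffineVariety

open MvPolynomial

section Generalities

variable {ι : Type*}

theorem isAlgebraicSet_setOf_eval_eq_zero {κ : Type*} (f : κ → MvPolynomial ι ℂ) :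
    IsAlgebraicSet {x : ι → ℂ | ∀ i, eval x (f i) = 0} := by
  refine ⟨Ideal.span (Set.range f), ?_⟩
  rw [zeroLocus_span]
  ext x
  simp [aeval_eq_eval]

theorem isAlgebraicSet_setOf_single (f : MvPolynomial ι ℂ) :
    IsAlgebraicSet {x : ι → ℂ | eval x f = 0} := by
  simpa using isAlgebraicSet_setOf_eval_eq_zero (κ := Unit) fun _ => f

theorem isAlgebraicSet_coordSubspace (S : Finset ι) :
    IsAlgebraicSet (coordSubspace S : Set (ι → ℂ)) := by
  convert isAlgebraicSet_setOf_eval_eq_zero (κ := S) (fun i => (X (i : ι) : MvPolynomial ι ℂ))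
  simp [coordSubspace]

theorem IsAlgebraicSet.inter {V W : Set (ι → ℂ)} (hV : IsAlgebraicSet V)
    (hW : IsAlgebraicSet W) : IsAlgebraicSet (V ∩ W) := by
  obtain ⟨I, rfl⟩ := hV
  obtain ⟨J, rfl⟩ := hW
  exact ⟨I ⊔ J, (zeroLocus_vanishingIdeal_galoisConnection (k := ℂ) (K := ℂ)).l_sup.symm⟩

theorem IsIrred.isPrime_vanishingIdeal {V : Set (ι → ℂ)} (hV : IsIrred V) :
    (vanishingIdeal ℂ V).IsPrime := by
  obtain ⟨⟨x, hx⟩, hirr⟩ := hV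
  refine ⟨fun htop => ?_, fun {p q} hpq => ?_⟩
  · have h1 : (1 : MvPolynomial ι ℂ) ∈ vanishingIdeal ℂ V := htop ▸ Submodule.mem_top
    simpa using h1 x hx
  · refine (hirr _ _ (isAlgebraicSet_setOf_single p) (isAlgebraicSet_setOf_single q)
      fun y hy => ?_).imp (fun h y hy => by simpa [aeval_eq_eval] using h hy)
      (fun h y hy => by simpa [aeval_eq_eval] using h hy)
    have := hpq y hy
    rw [map_mul, mul_eq_zero, aeval_eq_eval] at this
    exact this

theorem varietyDim_singleton (x : ι → ℂ) : varietyDim {x} = 0 := by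
  have : (vanishingIdeal ℂ {x}).IsMaximal := inferInstance
  let _ := Ideal.Quotient.field (vanishingIdeal ℂ {x})
  exact ringKrullDim_eq_zero_of_field _

/-- An irreducible algebraic set is its own component. -/
theorem IsPureOfCodim.varietyDim_add {W V : Set (ι → ℂ)} {c : ℕ} (h : IsPureOfCodim W V c)
    (hW : IsAlgebraicSet W) (hirr : IsIrred W) :
    varietyDim W + (c : WithBot ℕ∞) = varietyDim V :=
  h W ⟨⟨hW, hirr, subset_rfl⟩, fun _ hY _ => hY.2.2⟩

end Generalities

/-! ### Sections of a binary geometry by faces -/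

section BinaryGeometry

variable {ι : Type*} [Fintype ι] [DecidableEq ι] {Δ : SimplicialComplexOn ι}
  {U : Set (ι → ℂ)}

open Classical in
theorem eval_uPoly (a : ι → ι → ℕ) (i : ι) (x : ι → ℂ) :
    eval x (uPoly Δ a i) =
      x i + ∏ j ∈ Finset.univ.filter (fun j => ¬ Δ.Compatible j i), x j ^ a i j - 1 := by
  simp [uPoly]

theorem IsBinaryGeometry.isAlgebraicSet_inter (hU : IsBinaryGeometry Δ U) (S : Finset ι) :
    IsAlgebraicSet (U ∩ coordSubspace S) := by
  obtain ⟨a, -, rfl⟩ := hU.cut_out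
  exact (isAlgebraicSet_setOf_eval_eq_zero _).inter (isAlgebraicSet_coordSubspace S)

theorem IsBinaryGeometry.varietyDim_inter_add_card (hU : IsBinaryGeometry Δ U) {S : Finset ι}
    (hS : S ∈ Δ.faces) :
    varietyDim (U ∩ coordSubspace S) + (S.card : WithBot ℕ∞) =
      (Δ.faces.sup Finset.card : ℕ) := by
  obtain ⟨d, hd, hdim⟩ := hU.dim_eq
  rw [(hU.pure_codim S hS).varietyDim_add (hU.isAlgebraicSet_inter S) (hU.irreducible S hS), hdim]
  rw [SimplicialComplexOn.dim, sub_add_cancel] at hd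
  exact_mod_cast hd

/-- A coordinate that is incompatible with a vanishing coordinate equals `1`. -/
theorem IsBinaryGeometry.eq_one (hU : IsBinaryGeometry Δ U) {x : ι → ℂ} (hx : x ∈ U) {i j : ι}
    (hij : ¬ Δ.Compatible i j) (hi : x i = 0) : x j = 1 := by
  classical
  obtain ⟨a, ha, rfl⟩ := hU.cut_out
  have := hx j
  rw [eval_uPoly, Finset.prod_eq_zero (i := i) (by simpa using hij)
    (by rw [hi, zero_pow (ha j i hij).ne'])] at this
  linear_combination this

theorem IsBinaryGeometry.eq_one_of_insert_notMem (hU : IsBinaryGeometry Δ U) (hΔ : Δ.IsFlag)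
    {F : Finset ι} (hF : F ∈ Δ.faces) {x : ι → ℂ} (hx : x ∈ U ∩ coordSubspace F) {j : ι}
    (hj : insert j F ∉ Δ.faces) : x j = 1 := by
  obtain ⟨i, hi, hij⟩ := hΔ.exists_not_compatible hF hj
  exact hU.eq_one hx.1 hij (hx.2 i hi)

theorem IsBinaryGeometry.card_facet (hU : IsBinaryGeometry Δ U) (hΔ : Δ.IsFlag)
    {F : Finset ι} (hF : Δ.IsFacet F) : F.card = Δ.faces.sup Finset.card := by
  have hval : ∀ x ∈ U ∩ coordSubspace F, x = fun j => if j ∈ F then 0 else 1 := by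
    intro x hx
    ext j
    split_ifs with hj
    · exact hx.2 j hj
    · refine hU.eq_one_of_insert_notMem hΔ hF.1 hx fun hmem => hj ?_
      rw [← hF.2 _ hmem (Finset.subset_insert j F)]
      exact Finset.mem_insert_self j F
  have hsing : U ∩ coordSubspace F = {fun j => if j ∈ F then 0 else 1} :=
    Set.eq_singleton_iff_nonempty_unique_mem.mpr ⟨(hU.nonempty_iff F).mpr hF.1, hval⟩
  have := hU.varietyDim_inter_add_card hF.1
  rw [hsing, varietyDim_singleton, zero_add] at this
  exact_mod_cast this

/-- The equations of `U ∩ H_F` for a face `F` of codimension one. -/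
theorem IsBinaryGeometry.exists_link_equations (hU : IsBinaryGeometry Δ U) (hΔ : Δ.IsFlag)
    {F : Finset ι} (hF : F ∈ Δ.faces) (hc : F.card + 1 = Δ.faces.sup Finset.card) :
    ∃ a : ι → ι → ℕ,
      (∀ i ∈ Δ.linkVertices F, ∀ j ∈ Δ.linkVertices F, i ≠ j → 0 < a i j) ∧
      ∀ x ∈ U ∩ coordSubspace F, ∀ i ∈ Δ.linkVertices F,
        x i + ∏ j ∈ (Δ.linkVertices F).erase i, x j ^ a i j = 1 := by
  classical
  obtain ⟨a, ha, hUa⟩ := hU.cut_out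
  refine ⟨a, fun i hi j hj hij =>
    ha i j (hΔ.not_compatible_of_mem_linkVertices hc hj hi hij.symm), fun x hx i hi => ?_⟩
  have hx1 := hx.1
  rw [hUa] at hx1
  have hxi := hx1 i
  rw [eval_uPoly] at hxi
  rw [← sub_eq_zero, ← hxi]
  congr 2
  -- The dropped factors are 1: an index incompatible with `i` lies outside `F`, and if it is not in
  -- the link, its coordinate is 1.
  refine Finset.prod_subset (fun j hj => ?_) fun j hj hj' => ?_
  · rw [Finset.mem_erase] at hj
    simpa using hΔ.not_compatible_of_mem_linkVertices hc hj.2 hi hj.1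
  · rw [Finset.mem_filter] at hj
    have hji : j ≠ i := by
      rintro rfl
      exact hj.2 (by simpa [SimplicialComplexOn.Compatible] using hΔ.1 j)
    have hjF : j ∉ F := fun hjF => hj.2
      (Δ.down_closed _ (SimplicialComplexOn.mem_linkVertices.mp hi).2 _
        (by simp [Finset.insert_subset_iff, hjF]))
    have : insert j F ∉ Δ.faces := fun h =>
      hj' (Finset.mem_erase.mpr ⟨hji, SimplicialComplexOn.mem_linkVertices.mpr ⟨hjF, h⟩⟩)
    rw [hU.eq_one_of_insert_notMem hΔ hF hx this, one_pow]

theorem IsBinaryGeometry.card_linkVertices (hU : IsBinaryGeometry Δ U) (hΔ : Δ.IsFlag)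
    {F : Finset ι} (hF : F ∈ Δ.faces) (hc : F.card + 1 = Δ.faces.sup Finset.card) :
    (Δ.linkVertices F).card = 2 := by
  obtain ⟨a, ha, heq⟩ := hU.exists_link_equations hΔ hF hc
  obtain ⟨i, hi⟩ : (Δ.linkVertices F).Nonempty := by
    by_contra hne
    have hfacet : Δ.IsFacet F := by
      refine ⟨hF, fun G hG hFG => (hFG.antisymm fun j hj => ?_).symm⟩
      by_contra hjF
      exact hne ⟨j, SimplicialComplexOn.mem_linkVertices.mpr
        ⟨hjF, Δ.down_closed G hG _ (Finset.insert_subset hj hFG)⟩⟩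
    have := hU.card_facet hΔ hfacet
    omega
  obtain ⟨hiF, hiFace⟩ := SimplicialComplexOn.mem_linkVertices.mp hi
  set C := U ∩ coordSubspace F with hC
  have hprime : (vanishingIdeal ℂ C).IsPrime := (hU.irreducible F hF).isPrime_vanishingIdeal
  let mk := Ideal.Quotient.mk (vanishingIdeal ℂ C)
  have hmk : ∀ p : MvPolynomial ι ℂ, (∀ x ∈ C, eval x p = 0) → mk p = 0 := fun p hp =>
    Ideal.Quotient.eq_zero_iff_mem.mpr fun x hx => by simpa [aeval_eq_eval] using hp x hx
  have hrel : ∀ j ∈ Δ.linkVertices F,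
      mk (X j) + ∏ k ∈ (Δ.linkVertices F).erase j, mk (X k) ^ a j k = 1 := by
    intro j hj
    have := hmk (X j + ∏ k ∈ (Δ.linkVertices F).erase j, X k ^ a j k - 1) fun x hx => by
      simpa [eval_prod, sub_eq_zero] using heq x hx j hj
    simpa [sub_eq_zero] using this
  -- Otherwise the sections by `F` and by `insert i F` coincide, although their dimensions differ by
  -- one.
  have ht : mk (X i) ≠ 0 := by
    intro h0
    rw [Ideal.Quotient.eq_zero_iff_mem] at h0
    have hCeq : U ∩ coordSubspace (insert i F) = C := by
      refine Set.Subset.antisymm (fun x hx => ⟨hx.1, fun s hs =>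
        hx.2 s (Finset.mem_insert_of_mem hs)⟩) fun x hx => ⟨hx.1, fun s hs => ?_⟩
      rcases Finset.mem_insert.mp hs with rfl | hs
      · simpa using h0 x hx
      · exact hx.2 s hs
    have h1 := hU.varietyDim_inter_add_card hiFace
    have h2 := hU.varietyDim_inter_add_card hF
    rw [hCeq, Finset.card_insert_of_notMem hiF] at h1
    generalize varietyDim C = v at h1 h2
    induction v using WithBot.recBotCoe with
    | bot => exact WithBot.bot_ne_coe h1
    | coe v =>
      induction v using ENat.recTopCoe with
      | top => exact absurd h1 (by norm_cast; simp)
      | coe v =>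
        norm_cast at h1 h2
        omega
  -- Evaluation at `p` kills the `i`-th coordinate and fixes integers, so this coordinate divides no
  -- non-zero integer.
  obtain ⟨p, hp⟩ := (hU.nonempty_iff _).mpr hiFace
  have hpC : p ∈ C := ⟨hp.1, fun s hs => hp.2 s (Finset.mem_insert_of_mem hs)⟩
  let ev : MvPolynomial ι ℂ ⧸ vanishingIdeal ℂ C →+* ℂ :=
    Ideal.Quotient.lift _ (eval p) fun q hq => by simpa [aeval_eq_eval] using hq p hpC
  have hdvd : ∀ m : ℤ, mk (X i) ∣ (m : MvPolynomial ι ℂ ⧸ vanishingIdeal ℂ C) → m = 0 := by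
    intro m hm
    have := map_dvd ev hm
    have hevi : ev (mk (X i)) = 0 := by
      refine (Ideal.Quotient.lift_mk _ _ _).trans ?_
      rw [eval_X]
      exact hp.2 i (Finset.mem_insert_self i F)
    rw [hevi, zero_dvd_iff, map_intCast] at this
    exact_mod_cast this
  have := card_eq_one_of_binary_relations (K := (Δ.linkVertices F).erase i) ht hdvd
    (fun k => mk (X k)) (fun k => a k i) (fun k => a i k) a
    (fun k hk => ha k (Finset.mem_of_mem_erase hk) i hi (Finset.ne_of_mem_erase hk))
    (fun k hk => ha i hi k (Finset.mem_of_mem_erase hk) (Finset.ne_of_mem_erase hk).symm)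
    (fun k hk => by
      have h := hrel k (Finset.mem_of_mem_erase hk)
      rw [← Finset.mul_prod_erase _ _
        (Finset.mem_erase.mpr ⟨(Finset.ne_of_mem_erase hk).symm, hi⟩),
        Finset.erase_right_comm] at h
      exact eq_sub_of_add_eq h)
    (hrel i hi)
  rw [← Finset.card_erase_add_one hi, this]

theorem IsBinaryGeometry.isPseudomanifold (hU : IsBinaryGeometry Δ U) (hΔ : Δ.IsFlag) :
    Δ.IsPseudomanifold := by
  refine ⟨fun F G hF hG => ?_, fun F hF hdim => ?_⟩
  · rw [SimplicialComplexOn.faceDim, SimplicialComplexOn.faceDim, hU.card_facet hΔ hF,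
      hU.card_facet hΔ hG]
  have hc : F.card + 1 = Δ.faces.sup Finset.card := by
    rw [SimplicialComplexOn.faceDim, SimplicialComplexOn.dim] at hdim
    omega
  -- By purity, a facet containing `F` has exactly one more vertex.
  have himage : {G : Finset ι | Δ.IsFacet G ∧ F ⊆ G} =
      ((Δ.linkVertices F).image fun j => insert j F : Finset (Finset ι)) := by
    ext G
    simp only [Set.mem_ofPred_eq, Finset.coe_image, Set.mem_image, Finset.mem_coe,
      SimplicialComplexOn.mem_linkVertices]
    constructor
    · rintro ⟨hG, hFG⟩
      obtain ⟨j, hj, rfl⟩ := (Finset.covBy_iff_exists_insert (s := F) (t := G)).mp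
        (Finset.covBy_iff_card_sdiff_eq_one.mpr
          ⟨hFG, by rw [Finset.card_sdiff_of_subset hFG, hU.card_facet hΔ hG]; omega⟩)
      exact ⟨j, ⟨hj, hG.1⟩, rfl⟩
    · rintro ⟨j, ⟨hj, hjF⟩, rfl⟩
      exact ⟨SimplicialComplexOn.isFacet_of_card hjF
        (by rw [Finset.card_insert_of_notMem hj, hc]), Finset.subset_insert j F⟩
  rw [himage, Set.ncard_coe_finset, Finset.card_image_of_injOn, hU.card_linkVertices hΔ hF hc]
  intro j hj k hk hjk
  have hjk : insert j F = insert k F := hjk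
  have hjmem : j ∈ insert k F := hjk ▸ Finset.mem_insert_self j F
  exact (Finset.mem_insert.mp hjmem).resolve_right (SimplicialComplexOn.mem_linkVertices.mp hj).1

end BinaryGeometry

end AffineVariety

theorem mainTheorem2 (n : ℕ) (Δ : SimplicialComplexOn (Fin n)) (hΔ : Δ.IsFlag)
    (U : Set (Fin n → ℂ)) (hU : AffineVariety.IsBinaryGeometry Δ U) :
    Δ.IsPseudomanifold :=
  hU.isPseudomanifold hΔ
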